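/- Let $n\ge 1$, $r,s\ge 0$ and let $\eta=(n_1,\dots,n_r;\,m_1,\dots,m_s)$ be positive integers with $(n_1+\dots+n_r)+2(m_1+\dots+m_s)=n$ (either list may be empty). Let $\mathbb T_m(\mathbb R)$ be the set of lower triangular real $m\times m$ matrices all of whose diagonal entries are equal, let $\mathbb S$ be the set of matrices $\begin{bmatrix}\alpha&\beta\\-\beta&\alpha\end{bmatrix}$ with $\alpha,\beta\in\mathbb R$, and let $\mathbb B_m(\mathbb R)$ be the set of real $2m\times 2m$ matrices that, divided into $2\times2$ blocks, have all blocks in $\mathbb S$, are block lower triangular, and have equal diagonal blocks. Put $$\mathcal K_{\eta,r,s}(\mathbb R)=\mathbb T_{n_1}(\mathbb R)\oplus\dots\oplus\mathbb T_{n_r}(\mathbb R)\oplus\mathbb B_{m_1}(\mathbb R)\oplus\dots\oplus\mathbb B_{m_s}(\mathbb R)$$ (block diagonal matrices) and $\mathcal K^*_{\eta,r,s}(\mathbb R)=\mathcal K_{\eta,r,s}(\mathbb R)\cap \mathrm{GL}(n,\mathbb R)$. Let $u_0\in\mathbb R^n$ be the vector whose first coordinate in each of the $r+s$ blocks is $1$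 and whose other coordinates are $0$. Let $G$ be an abelian subgroup of $\mathrm{GL}(n,\mathbb R)$ and let $P\in \mathrm{GL}(n,\mathbb R)$ be such that $P^{-1}GP\subset\mathcal K^*_{\eta,r,s}(\mathbb R)$. Put $v_0=Pu_0$, $\mathrm g=\{B\in P\,\mathcal K_{\eta,r,s}(\mathbb R)\,P^{-1}: e^B\in G\}$, $\mathrm g_{v_0}=\{Bv_0: B\in\mathrm g\}$ and $G(v)=\{Av: A\in G\}$. For $M\in P^{-1}GP$ let $\mu_k(M)$ be the unique eigenvalue of the $k$-th diagonal block of $M$, $1\le k\le r$, and let $\mathrm{ind}(G)$ be the number of $k\in\{1,\dots,r\}$ for which there is $M\in P^{-1}GP$ with $\mu_k(M)<0$ and $\mu_i(M)>0$ for all $i\in\{1,\dots,r\}\setminus\{k\}$ (so $\mathrm{ind}(G)=0$ if $r=0$). The following are equivalent: (i) $G$ is topologically transitive, that is, $G(v)$ is dense in $\mathbb R^n$ for some $v\in\mathbb R^n$; (ii) $G(v_0)$ is dense in $\mathbb R^n$; (iii) $\mathrm g_{v_0}$ is an additive subgroup of $\mathbb R^n$ that is dense in $\mathbb R^n$, and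 $\mathrm{ind}(G)=r$. -/

import Mathlib

namespace TopTransitive

open Matrix

/-- A partition `η = (n₁,…,n_r; m₁,…,m_s)` of `n`: positive integers with
`(n₁ + ⋯ + n_r) + 2 (m₁ + ⋯ + m_s) = n`. Either list may be empty. -/
structure BlockPartition (n r s : ℕ) where
  /-- the sizes `n₁,…,n_r` of the real blocks -/
  realSize : Fin r → ℕ
  /-- the half-sizes `m₁,…,m_s` of the complex blocks -/
  complexSize : Fin s → ℕ
  realSize_pos : ∀ k, 0 < realSize k
  complexSize_pos : ∀ l, 0 < complexSize l
  sum_eq : ∑ k, realSize k + 2 * ∑ l, complexSize l = n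

/-- `𝕋_m(ℝ)`: lower triangular matrices with constant diagonal. -/
def TSet (m : ℕ) : Set (Matrix (Fin m) (Fin m) ℝ) :=
  {M | (∃ μ : ℝ, ∀ i, M i i = μ) ∧ ∀ i j, i < j → M i j = 0}

/-- `𝕊`: the real `2 × 2` matrices `[α, β; -β, α]`. -/
def SSet : Set (Matrix (Fin 2) (Fin 2) ℝ) :=
  {M | ∃ α β : ℝ, M = !![α, β; -β, α]}

/-- `𝔹_m(ℝ)`: the `2m × 2m` matrices made of `m × m` blocks from `𝕊` that are block lower
triangular with constant block diagonal. The index `(i, a)` is row `a` of the `i`-th block row. -/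
def BSet (m : ℕ) : Set (Matrix (Fin m × Fin 2) (Fin m × Fin 2) ℝ) :=
  {M | ∃ C : Matrix (Fin m) (Fin m) (Matrix (Fin 2) (Fin 2) ℝ),
    (∀ i j, C i j ∈ SSet) ∧ (∃ D, ∀ i, C i i = D) ∧ (∀ i j, i < j → C i j = 0) ∧
    M = Matrix.comp _ _ _ _ _ C}

namespace BlockPartition

variable {n r s : ℕ}

/-- Coordinates of `ℝⁿ` labelled by block and position in the block. -/
abbrev Index (η : BlockPartition n r s) : Type :=
  (Σ k : Fin r, Fin (η.realSize k)) ⊕ (Σ l : Fin s, Fin (η.complexSize l) × Fin 2)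

/-- The order-preserving enumeration of the block coordinates by `0, …, n - 1`: first the real
blocks, then the complex blocks, each block in its own (lexicographic) order. -/
def indexEquiv (η : BlockPartition n r s) : η.Index ≃ Fin n :=
  (Equiv.sumCongr finSigmaFinEquiv
    ((Equiv.sigmaCongrRight fun _ => finProdFinEquiv).trans finSigmaFinEquiv)).trans
  (finSumFinEquiv.trans (finCongr (by
    have h := η.sum_eq
    rw [mul_comm, Finset.sum_mul] at h
    exact h)))

/-- `𝒦_{η,r,s}(ℝ) = 𝕋_{n₁} ⊕ ⋯ ⊕ 𝕋_{n_r} ⊕ 𝔹_{m₁} ⊕ ⋯ ⊕ 𝔹_{m_s}`, the block diagonal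
matrices with these blocks. -/
def KSet (η : BlockPartition n r s) : Set (Matrix (Fin n) (Fin n) ℝ) :=
  {M | ∃ (T : ∀ k, Matrix (Fin (η.realSize k)) (Fin (η.realSize k)) ℝ)
      (B : ∀ l, Matrix (Fin (η.complexSize l) × Fin 2) (Fin (η.complexSize l) × Fin 2) ℝ),
    (∀ k, T k ∈ TSet (η.realSize k)) ∧ (∀ l, B l ∈ BSet (η.complexSize l)) ∧
    M = Matrix.reindex η.indexEquiv η.indexEquiv
      (Matrix.fromBlocks (Matrix.blockDiagonal' T) 0 0 (Matrix.blockDiagonal' B))}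

/-- `𝒦*_{η,r,s}(ℝ) = 𝒦_{η,r,s}(ℝ) ∩ GL(n, ℝ)`. -/
def KStar (η : BlockPartition n r s) : Set (GL (Fin n) ℝ) :=
  {A | (A : Matrix (Fin n) (Fin n) ℝ) ∈ η.KSet}

/-- The `k`-th real diagonal block `M_k` of `M`. -/
def realBlock (η : BlockPartition n r s) (M : Matrix (Fin n) (Fin n) ℝ) (k : Fin r) :
    Matrix (Fin (η.realSize k)) (Fin (η.realSize k)) ℝ :=
  M.submatrix (fun i => η.indexEquiv (Sum.inl ⟨k, i⟩)) (fun i => η.indexEquiv (Sum.inl ⟨k, i⟩))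

/-- The index of a subset of `𝒦*_{η,r,s}(ℝ)`: the number of `k` for which some member `M` has
`μ_k < 0` and `μ_i > 0` for all `i ≠ k`, where `μ_i` is the (unique) eigenvalue of the `i`-th
real block of `M`. It is `0` if `r = 0`. -/
noncomputable def ind (η : BlockPartition n r s) (H : Set (GL (Fin n) ℝ)) : ℕ :=
  Set.ncard {k : Fin r | ∃ M ∈ H, ∃ μ : Fin r → ℝ,
    (∀ i, Module.End.HasEigenvalue
      (Matrix.toLin' (η.realBlock (M : Matrix (Fin n) (Fin n) ℝ) i)) (μ i)) ∧
    μ k < 0 ∧ ∀ i, i ≠ k → 0 < μ i}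

/-- `u₀ = [e_{1,1},…,e_{r,1}; f_{1,1},…,f_{s,1}]ᵀ`: the first coordinate of each block is `1`,
all others are `0`. -/
def u₀ (η : BlockPartition n r s) : Fin n → ℝ := fun j =>
  match η.indexEquiv.symm j with
  | Sum.inl ⟨_, i⟩ => if (i : ℕ) = 0 then 1 else 0
  | Sum.inr ⟨_, (i, a)⟩ => if (i : ℕ) = 0 ∧ a = 0 then 1 else 0

/-- `v₀ = P u₀`. -/
def v₀ (η : BlockPartition n r s) (P : GL (Fin n) ℝ) : Fin n → ℝ :=
  (P : Matrix (Fin n) (Fin n) ℝ) *ᵥ η.u₀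

/-- `g = exp⁻¹(G) ∩ P 𝒦_{η,r,s}(ℝ) P⁻¹`. -/
def gSet (η : BlockPartition n r s) (G : Subgroup (GL (Fin n) ℝ)) (P : GL (Fin n) ℝ) :
    Set (Matrix (Fin n) (Fin n) ℝ) :=
  {B | (∃ A ∈ G, NormedSpace.exp B = (A : Matrix (Fin n) (Fin n) ℝ)) ∧
    ∃ C ∈ η.KSet, B = (P : Matrix (Fin n) (Fin n) ℝ) * C *
      ((P⁻¹ : GL (Fin n) ℝ) : Matrix (Fin n) (Fin n) ℝ)}

/-- `g_u = {B u : B ∈ g}`. -/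
def gOrbit (η : BlockPartition n r s) (G : Subgroup (GL (Fin n) ℝ)) (P : GL (Fin n) ℝ)
    (u : Fin n → ℝ) : Set (Fin n → ℝ) :=
  {w | ∃ B ∈ η.gSet G P, w = B *ᵥ u}

end BlockPartition

variable {n : ℕ}

/-- `P⁻¹ G P`. -/
def conjSet (G : Subgroup (GL (Fin n) ℝ)) (P : GL (Fin n) ℝ) : Set (GL (Fin n) ℝ) :=
  {M | ∃ A ∈ G, M = P⁻¹ * A * P}

/-- The orbit `G(v) = {A v : A ∈ G}`. -/
def orbit (G : Subgroup (GL (Fin n) ℝ)) (v : Fin n → ℝ) : Set (Fin n → ℝ) :=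
  {w | ∃ A ∈ G, w = (A : Matrix (Fin n) (Fin n) ℝ) *ᵥ v}

/-- `G` is topologically transitive: some orbit is dense in `ℝⁿ`. -/
def IsTopTransitive (G : Subgroup (GL (Fin n) ℝ)) : Prop :=
  ∃ v : Fin n → ℝ, Dense (orbit G v)

end TopTransitive

namespace TopTransitive

open Matrix NormedSpace

/-! Write `K` for the conjugated block algebra and `u` for its distinguished vector. The leading
coordinates `c` satisfy `c (B v) = c (B u) * c v` for `B` in `K`, so `c (B u)` is the vector of
block eigenvalues; each `B` is a central scalar-block part plus a nilpotent. `BlockModel` records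
exactly this.

If `G v` is dense, the commutative algebra spanned by `G` maps `v` onto the whole space. Some `a` in
it has `a v = u`; then `c (a u) * c v = 1`, so `a` is invertible, and as it commutes with `G` it
carries `G v` onto `G u`.

When `u` is cyclic for a commutative algebra, evaluation at `u` is a linear isomorphism `E` from
that algebra to the space. If `G u` is dense, openness of `exp` on the algebra of `G` makes the
logarithms dense at `u`, and applying `c` to the dense orbit produces every sign pattern.

Conversely, `exp` reflects commutation on `K` (`commute_of_commute_exp_exp`), so the logarithms of
`G` commute. This makes their values at `u` a group and, when these are dense, makes `u` cyclic for
the algebra they generate. By connectedness (`subset_range_exp`), every vector with positive real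
and nonzero complex leading entries is `E (exp y)`. An element of `G` with suitable signs moves a
generic vector into that region, and continuity of `exp` transfers density from the logarithms to `G
u`. -/

/-! ### Exponentials in commutative Banach algebras -/

/-- The exponential of a commutative real Banach algebra is an open map. -/
theorem isOpenMap_exp {𝔸 : Type*} [NormedCommRing 𝔸] [NormedAlgebra ℝ 𝔸] [CompleteSpace 𝔸] :
    IsOpenMap (exp : 𝔸 → 𝔸) := by
  let _ : NormedAlgebra ℚ 𝔸 := NormedAlgebra.restrictScalars ℚ ℝ 𝔸
  refine isOpenMap_iff_nhds_le.2 fun x => ?_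
  have h := hasStrictFDerivAt_exp (𝕂 := ℝ) (x := x)
  -- The derivative at `x` is multiplication by the unit `exp x`, hence surjective.
  refine (h.map_nhds_eq_of_surj ?_).ge
  rw [LinearMap.range_eq_top]
  intro y
  obtain ⟨v, hv⟩ := isUnit_exp x
  exact ⟨(↑v⁻¹ : 𝔸) * y, by simp [← hv]⟩

/-- A connected set of units through `1` lies in the range of the exponential. -/
theorem subset_range_exp {𝔸 : Type*} [NormedCommRing 𝔸] [NormedAlgebra ℝ 𝔸] [CompleteSpace 𝔸]
    {U : Set 𝔸} (hU : IsPreconnected U) (hunit : ∀ x ∈ U, IsUnit x) (h1 : (1 : 𝔸) ∈ U) :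
    U ⊆ Set.range (exp : 𝔸 → 𝔸) := by
  let _ : NormedAlgebra ℚ 𝔸 := NormedAlgebra.restrictScalars ℚ ℝ 𝔸
  have hopen : IsOpen (Set.range (exp : 𝔸 → 𝔸)) := isOpenMap_exp.isOpen_range
  -- The range of `exp` is an open subgroup of the units. `W` is the union of its other cosets, also
  -- open, so a connected set of units cannot leave the subgroup.
  let W : Set 𝔸 := ⋃ x : {x : 𝔸ˣ // (x : 𝔸) ∉ Set.range (exp : 𝔸 → 𝔸)},
    (fun y => (x.1 : 𝔸) * y) '' Set.range (exp : 𝔸 → 𝔸)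
  have hW : IsOpen W := isOpen_iUnion fun x => (isOpenMap_smul x.1) _ hopen
  refine hU.subset_left_of_subset_union hopen hW ?_ ?_ ⟨1, h1, 0, exp_zero⟩
  · rw [Set.disjoint_left]
    rintro _ ⟨a, rfl⟩ hmem
    obtain ⟨⟨x, hx⟩, _, ⟨b, rfl⟩, hb⟩ := Set.mem_iUnion.1 hmem
    refine hx ⟨a + -b, ?_⟩
    rw [exp_add, ← hb, mul_assoc, ← exp_add, add_neg_cancel, exp_zero, mul_one]
  · intro x hx
    by_cases hr : x ∈ Set.range (exp : 𝔸 → 𝔸)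
    · exact Or.inl hr
    · obtain ⟨y, rfl⟩ := hunit x hx
      exact Or.inr (Set.mem_iUnion.2 ⟨⟨y, hr⟩, 1, ⟨0, exp_zero⟩, mul_one _⟩)

/-! ### Nilpotent matrices and commutation -/

theorem exp_nsmul_eq_sum_of_pow_eq_zero {ι : Type*} [Fintype ι] [DecidableEq ι]
    {N : Matrix ι ι ℝ} {d : ℕ} (hd : N ^ d = 0) (k : ℕ) :
    exp (k • N) = ∑ j ∈ Finset.range d, ((k : ℝ) ^ j / (j.factorial : ℝ)) • N ^ j := by
  rw [exp_eq_tsum ℝ]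
  refine (tsum_eq_sum (s := Finset.range d) ?_).trans ?_
  · intro j hj
    have : N ^ j = 0 := pow_eq_zero_of_le (by simpa using hj) hd
    rw [← Nat.cast_smul_eq_nsmul ℝ, smul_pow, this, smul_zero, smul_zero]
  · refine Finset.sum_congr rfl fun j _ => ?_
    rw [← Nat.cast_smul_eq_nsmul ℝ, smul_pow, smul_smul]
    congr 1
    ring

/-- A nilpotent matrix commutes with everything that its exponential commutes with. -/
theorem commute_of_commute_exp_of_isNilpotent {ι : Type*} [Fintype ι] [DecidableEq ι]
    {N M : Matrix ι ι ℝ} (hN : IsNilpotent N) (h : Commute (exp N) M) : Commute N M := by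
  obtain ⟨d, hd⟩ := hN
  -- Enlarging the exponent ensures that degree 1 occurs in the truncated series.
  have hd' : N ^ (d + 2) = 0 := pow_eq_zero_of_le (by omega) hd
  ext a b
  -- `p k` is the `(a, b)` entry of the commutator of `exp (k • N)` with `M`. It vanishes at every
  -- natural `k`, so `p = 0`, and its linear coefficient is the entry of `N * M - M * N`.
  let p : Polynomial ℝ := ∑ j ∈ Finset.range (d + 2),
    Polynomial.monomial j (((N ^ j * M - M * N ^ j) a b) / (j.factorial : ℝ))
  have hp : p = 0 := by
    refine Polynomial.eq_zero_of_infinite_isRoot p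
      ((Set.infinite_range_of_injective (Nat.cast_injective (R := ℝ))).mono ?_)
    rintro _ ⟨k, rfl⟩
    have hk : Commute (exp (k • N)) M := by
      rw [Matrix.exp_nsmul]; exact h.pow_left k
    rw [exp_nsmul_eq_sum_of_pow_eq_zero hd'] at hk
    have := sub_eq_zero.2 hk.eq
    rw [Finset.sum_mul, Finset.mul_sum, ← Finset.sum_sub_distrib] at this
    replace this := congrArg (fun X : Matrix ι ι ℝ => X a b) this
    simp only [Matrix.sum_apply, Matrix.zero_apply] at this
    simp only [Set.mem_ofPred_eq, Polynomial.IsRoot, p, Polynomial.eval_finsetSum,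
      Polynomial.eval_monomial]
    refine Eq.trans (Finset.sum_congr rfl fun j _ => ?_) this
    simp only [smul_mul_assoc, mul_smul_comm, ← smul_sub, Matrix.smul_apply, smul_eq_mul]
    ring
  have h1 := congrArg (fun q => Polynomial.coeff q 1) hp
  simp only [p, Polynomial.finsetSum_coeff, Polynomial.coeff_monomial] at h1
  rw [Finset.sum_ite_eq'] at h1
  simpa [sub_eq_zero] using h1

/-! ### Commutative matrix algebras as Banach algebras -/

/-- A commutative algebra of real matrices is the faithful image of a finite-dimensional
commutative Banach algebra. -/
theorem exists_normedCommRing_of_commute {n : ℕ} (A : Subalgebra ℝ (Matrix (Fin n) (Fin n) ℝ))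
    (hA : ∀ a ∈ A, ∀ b ∈ A, Commute a b) :
    ∃ (𝔸 : Type) (_ : NormedCommRing 𝔸) (_ : NormedAlgebra ℝ 𝔸)
      (f : 𝔸 →ₐ[ℝ] Matrix (Fin n) (Fin n) ℝ),
      FiniteDimensional ℝ 𝔸 ∧ Function.Injective f ∧ f.range = A := by
  -- Continuous endomorphisms supply the submultiplicative operator norm.
  let e : Matrix (Fin n) (Fin n) ℝ ≃ₐ[ℝ] ((Fin n → ℝ) →L[ℝ] (Fin n → ℝ)) :=
    Matrix.toLinAlgEquiv'.trans (Module.End.toContinuousLinearMap (Fin n → ℝ))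
  let B := A.map e.toAlgHom
  have hB : ∀ a ∈ B, ∀ b ∈ B, a * b = b * a := by
    rintro _ ⟨a, ha, rfl⟩ _ ⟨b, hb, rfl⟩
    exact ((hA a ha b hb).map e.toAlgHom).eq
  let i : NormedCommRing B :=
    { (inferInstance : NormedRing B) with
      mul_comm := fun a b => Subtype.ext (hB a a.2 b b.2) }
  refine ⟨B, i, inferInstance, e.symm.toAlgHom.comp B.val, ?_, ?_, ?_⟩
  · exact FiniteDimensional.finiteDimensional_submodule (Subalgebra.toSubmodule B)
  · exact e.symm.injective.comp Subtype.val_injective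
  · ext x
    constructor
    · rintro ⟨⟨_, a, ha, rfl⟩, rfl⟩
      simpa using ha
    · intro hx
      exact ⟨⟨e x, x, hx, rfl⟩, by simp⟩

theorem map_exp_matrix {𝔸 : Type*} [NormedCommRing 𝔸] [NormedAlgebra ℝ 𝔸]
    [FiniteDimensional ℝ 𝔸] {n : ℕ} (f : 𝔸 →ₐ[ℝ] Matrix (Fin n) (Fin n) ℝ) (x : 𝔸) :
    f (exp x) = exp (f x) := by
  have : CompleteSpace 𝔸 := FiniteDimensional.complete ℝ 𝔸
  have hf : Continuous f := f.toLinearMap.continuous_of_finiteDimensional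
  have h := (exp_series_hasSum_exp' (𝕂 := ℝ) x).map f hf
  refine h.tsum_eq.symm.trans ?_
  rw [exp_eq_tsum ℝ]
  simp

/-! ### The abstract block model -/

/-- The target of the vector of eigenvalues of a block matrix. -/
abbrev Eigen (r s : ℕ) : Type := (Fin r → ℝ) × (Fin s → ℂ)

/-- An algebra `K` of real matrices with a vector `u`, modelled on the block lower triangular
matrices with constant block diagonals: `c` reads off the leading coordinates of a vector,
`B ↦ c (B u)` is the vector of eigenvalues of `B ∈ K`, and `σ` is a central section of it. -/
structure BlockModel (n r s : ℕ) where
  K : Subalgebra ℝ (Matrix (Fin n) (Fin n) ℝ)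
  u : Fin n → ℝ
  c : (Fin n → ℝ) →ₗ[ℝ] Eigen r s
  σ : Eigen r s →ₐ[ℝ] Matrix (Fin n) (Fin n) ℝ
  σ_mem : ∀ a, σ a ∈ K
  σ_commute : ∀ a, ∀ B ∈ K, Commute (σ a) B
  c_σ : ∀ a, c (σ a *ᵥ u) = a
  c_mulVec : ∀ B ∈ K, ∀ v, c (B *ᵥ v) = c (B *ᵥ u) * c v
  isNilpotent : ∀ B ∈ K, c (B *ᵥ u) = 0 → IsNilpotent B

namespace BlockModel

variable {n r s : ℕ} (D : BlockModel n r s)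

theorem c_u : D.c D.u = 1 := by
  have := D.c_σ 1
  rwa [map_one, Matrix.one_mulVec] at this

theorem c_surjective : Function.Surjective D.c := fun a => ⟨_, D.c_σ a⟩

theorem continuous_c : Continuous D.c := D.c.continuous_of_finiteDimensional

theorem isNilpotent_sub {B : Matrix (Fin n) (Fin n) ℝ} (hB : B ∈ D.K) :
    IsNilpotent (B - D.σ (D.c (B *ᵥ D.u))) := by
  refine D.isNilpotent _ (sub_mem hB (D.σ_mem _)) ?_
  rw [Matrix.sub_mulVec, map_sub, D.c_σ, sub_self]

theorem isUnit {B : Matrix (Fin n) (Fin n) ℝ} (hB : B ∈ D.K)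
    (h : IsUnit (D.c (B *ᵥ D.u))) : IsUnit B := by
  have := (D.isNilpotent_sub hB).isUnit_add_left_of_commute (h.map D.σ)
    ((D.σ_commute _ _ (sub_mem hB (D.σ_mem _))).symm)
  rwa [add_sub_cancel] at this

/-- Split `B = S + N` with `S` central in `K` and `N` nilpotent. Removing the factor `exp S` leaves
`exp N` commuting with `M`, which the nilpotent case settles. -/
theorem commute_of_commute_exp {B M : Matrix (Fin n) (Fin n) ℝ} (hB : B ∈ D.K) (hM : M ∈ D.K)
    (h : Commute (exp B) M) : Commute B M := by
  set S := D.σ (D.c (B *ᵥ D.u)) with hS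
  have hSM : Commute S M := D.σ_commute _ _ hM
  have hSN : Commute S (B - S) := D.σ_commute _ _ (sub_mem hB (D.σ_mem _))
  have hexp : exp B = exp S * exp (B - S) := by
    rw [← Matrix.exp_add_of_commute _ _ hSN, add_sub_cancel]
  have hN : exp (B - S) = exp (-S) * exp B := by
    rw [hexp, ← mul_assoc, ← Matrix.exp_add_of_commute _ _ (Commute.refl S).neg_left,
      neg_add_cancel, exp_zero, one_mul]
  have hSM' : Commute (exp (-S)) M := hSM.neg_left.exp_left
  have := commute_of_commute_exp_of_isNilpotent (D.isNilpotent_sub hB) (hN ▸ hSM'.mul_left h)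
  simpa [← hS] using this.add_left hSM

theorem commute_of_commute_exp_exp {B M : Matrix (Fin n) (Fin n) ℝ} (hB : B ∈ D.K)
    (hM : M ∈ D.K) (h : Commute (exp B) (exp M)) : Commute B M := by
  -- `K` is closed, so `exp B` can play the role of `M` while the exponential is first removed from
  -- the other matrix.
  have hE : exp B ∈ D.K := NormedSpace.exp_mem (R := ℝ) (s := D.K)
    (Submodule.closed_of_finiteDimensional (Subalgebra.toSubmodule D.K)) hB
  exact D.commute_of_commute_exp hB hM (D.commute_of_commute_exp hM hE h.symm).symm

end BlockModel

/-! ### Cyclic vectors -/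

/-- Evaluation at `u` of a commutative algebra of matrices for which `u` is cyclic. -/
noncomputable def evalEquiv {𝔸 : Type*} [CommRing 𝔸] [Algebra ℝ 𝔸] {n : ℕ}
    (f : 𝔸 →ₐ[ℝ] Matrix (Fin n) (Fin n) ℝ) (hf : Function.Injective f) (u : Fin n → ℝ)
    (hu : ∀ v, ∃ a, f a *ᵥ u = v) : 𝔸 ≃ₗ[ℝ] (Fin n → ℝ) :=
  LinearEquiv.ofBijective
    { toFun := fun a => f a *ᵥ u
      map_add' := fun a b => by rw [map_add, Matrix.add_mulVec]
      map_smul' := fun t a => by rw [map_smul, Matrix.smul_mulVec, RingHom.id_apply] }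
    ⟨by
      rw [← LinearMap.ker_eq_bot, LinearMap.ker_eq_bot']
      intro a (ha : f a *ᵥ u = 0)
      refine hf ?_
      rw [map_zero]
      refine Matrix.toLin'.injective (LinearMap.ext fun v => ?_)
      -- If `a` kills `u`, it kills every `b u` by commutativity, hence everything.
      obtain ⟨b, rfl⟩ := hu v
      rw [Matrix.toLin'_apply, Matrix.mulVec_mulVec, ← map_mul, mul_comm, map_mul,
        ← Matrix.mulVec_mulVec, ha, Matrix.mulVec_zero, map_zero, LinearMap.zero_apply], hu⟩

@[simp] theorem evalEquiv_apply {𝔸 : Type*} [CommRing 𝔸] [Algebra ℝ 𝔸] {n : ℕ}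
    (f : 𝔸 →ₐ[ℝ] Matrix (Fin n) (Fin n) ℝ) (hf : Function.Injective f) (u : Fin n → ℝ)
    (hu : ∀ v, ∃ a, f a *ᵥ u = v) (a : 𝔸) : evalEquiv f hf u hu a = f a *ᵥ u := rfl

/-- The vectors `a v` form a finite-dimensional, hence closed, subspace containing a dense set. -/
theorem exists_mulVec_eq_of_dense {n : ℕ} {A : Subalgebra ℝ (Matrix (Fin n) (Fin n) ℝ)}
    {v : Fin n → ℝ} {S : Set (Fin n → ℝ)} (hS : Dense S) (h : ∀ w ∈ S, ∃ a ∈ A, a *ᵥ v = w)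
    (w : Fin n → ℝ) : ∃ a ∈ A, a *ᵥ v = w := by
  let L : Submodule ℝ (Fin n → ℝ) :=
    (Subalgebra.toSubmodule A).map ((Matrix.mulVecBilin ℝ ℝ).flip v)
  have hL : IsClosed (L : Set (Fin n → ℝ)) := L.closed_of_finiteDimensional
  have : w ∈ closure S := hS w
  exact closure_minimal (t := (L : Set (Fin n → ℝ))) h hL this

theorem commute_of_mem_adjoin {n : ℕ} {S : Set (Matrix (Fin n) (Fin n) ℝ)}
    (hS : ∀ a ∈ S, ∀ b ∈ S, Commute a b) :
    ∀ a ∈ Algebra.adjoin ℝ S, ∀ b ∈ Algebra.adjoin ℝ S, Commute a b := fun _ ha _ hb =>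
  Algebra.commute_of_mem_adjoin_of_forall_mem_commute hb fun c hc =>
    (Algebra.commute_of_mem_adjoin_of_forall_mem_commute ha fun d hd => hS c hc d hd).symm

/-! ### The equivalences in a block model -/

/-- The eigenvalue vectors with positive real and nonzero complex entries. -/
def positiveEigen (r s : ℕ) : Set (Eigen r s) :=
  (Set.univ.pi fun _ => Set.Ioi 0) ×ˢ (Set.univ.pi fun _ => {0}ᶜ)

theorem mem_positiveEigen {r s : ℕ} {a : Eigen r s} :
    a ∈ positiveEigen r s ↔ (∀ k, 0 < a.1 k) ∧ ∀ l, a.2 l ≠ 0 := by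
  simp [positiveEigen, Set.mem_prod, Set.mem_pi]

theorem isPreconnected_positiveEigen (r s : ℕ) : IsPreconnected (positiveEigen r s) :=
  (isPreconnected_univ_pi fun _ => isPreconnected_Ioi).prod (isPreconnected_univ_pi fun _ =>
    (isConnected_compl_singleton_of_one_lt_rank (by simp) 0).isPreconnected)

theorem isUnit_of_forall_ne_zero {r s : ℕ} {a : Eigen r s} (h₁ : ∀ k, a.1 k ≠ 0)
    (h₂ : ∀ l, a.2 l ≠ 0) : IsUnit a :=
  Prod.isUnit_iff.2 ⟨Pi.isUnit_iff.2 fun k => (h₁ k).isUnit, Pi.isUnit_iff.2 fun l =>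
    (h₂ l).isUnit⟩

namespace BlockModel

variable {n r s : ℕ} (D : BlockModel n r s) (G : Subgroup (GL (Fin n) ℝ))

/-- The matrices of `K` whose exponential lies in `G`. -/
def logSet : Set (Matrix (Fin n) (Fin n) ℝ) :=
  {B | B ∈ D.K ∧ ∃ A ∈ G, exp B = (A : Matrix (Fin n) (Fin n) ℝ)}

/-- The images of `u` under the matrices of `K` whose exponential lies in `G`. -/
def logOrbit : Set (Fin n → ℝ) := {w | ∃ B ∈ D.logSet G, w = B *ᵥ D.u}

variable {D G}

theorem commute_of_mem_logSet (hG : ∀ A ∈ G, ∀ B ∈ G, A * B = B * A) :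
    ∀ B ∈ D.logSet G, ∀ B' ∈ D.logSet G, Commute B B' := by
  rintro B ⟨hB, A, hA, hAB⟩ B' ⟨hB', A', hA', hAB'⟩
  refine D.commute_of_commute_exp_exp hB hB' ?_
  rw [hAB, hAB']
  exact congrArg Units.val (hG A hA A' hA')

theorem exists_addSubgroup_eq_logOrbit (hG : ∀ A ∈ G, ∀ B ∈ G, A * B = B * A) :
    ∃ H : AddSubgroup (Fin n → ℝ), (H : Set (Fin n → ℝ)) = D.logOrbit G := by
  refine ⟨{ carrier := D.logOrbit G, zero_mem' := ?_, add_mem' := ?_, neg_mem' := ?_ }, rfl⟩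
  · rintro _ _ ⟨B, hB, rfl⟩ ⟨B', hB', rfl⟩
    have hc := commute_of_mem_logSet hG B hB B' hB'
    obtain ⟨hBK, A, hA, hAB⟩ := hB
    obtain ⟨hBK', A', hA', hAB'⟩ := hB'
    refine ⟨B + B', ⟨add_mem hBK hBK', A * A', mul_mem hA hA', ?_⟩, (add_mulVec _ _ _).symm⟩
    rw [Matrix.exp_add_of_commute _ _ hc, hAB, hAB', Units.val_mul]
  · exact ⟨0, ⟨zero_mem _, 1, one_mem _, by simp⟩, by simp⟩
  · rintro _ ⟨B, ⟨hBK, A, hA, hAB⟩, rfl⟩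
    refine ⟨-B, ⟨neg_mem hBK, A⁻¹, inv_mem hA, ?_⟩, (neg_mulVec _ _).symm⟩
    rw [Matrix.exp_neg, hAB, Matrix.coe_units_inv]

theorem adjoin_le (hK : ∀ A ∈ G, (A : Matrix (Fin n) (Fin n) ℝ) ∈ D.K) :
    Algebra.adjoin ℝ (Units.val '' (G : Set (GL (Fin n) ℝ))) ≤ D.K :=
  Algebra.adjoin_le (by rintro _ ⟨A, hA, rfl⟩; exact hK A hA)

theorem commute_of_mem_adjoin_image (hG : ∀ A ∈ G, ∀ B ∈ G, A * B = B * A) :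
    ∀ a ∈ Algebra.adjoin ℝ (Units.val '' (G : Set (GL (Fin n) ℝ))),
    ∀ b ∈ Algebra.adjoin ℝ (Units.val '' (G : Set (GL (Fin n) ℝ))), Commute a b :=
  commute_of_mem_adjoin (by
    rintro _ ⟨A, hA, rfl⟩ _ ⟨B, hB, rfl⟩
    exact congrArg Units.val (hG A hA B hB))

theorem exists_adjoin_mulVec_eq {v : Fin n → ℝ} (h : Dense (orbit G v)) (w : Fin n → ℝ) :
    ∃ a ∈ Algebra.adjoin ℝ (Units.val '' (G : Set (GL (Fin n) ℝ))), a *ᵥ v = w :=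
  exists_mulVec_eq_of_dense h (by
    rintro _ ⟨A, hA, rfl⟩
    exact ⟨A, Algebra.subset_adjoin ⟨A, hA, rfl⟩, rfl⟩) w

/-- If some orbit of `G` is dense, then so is the orbit of `u`. -/
theorem dense_orbit_of_dense_orbit (hG : ∀ A ∈ G, ∀ B ∈ G, A * B = B * A)
    (hK : ∀ A ∈ G, (A : Matrix (Fin n) (Fin n) ℝ) ∈ D.K) {v : Fin n → ℝ}
    (h : Dense (orbit G v)) : Dense (orbit G D.u) := by
  obtain ⟨a, ha, hav⟩ := exists_adjoin_mulVec_eq h D.u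
  have hu : IsUnit a := D.isUnit (adjoin_le hK ha) (by
    refine IsUnit.of_mul_eq_one (D.c v) ?_
    rw [← D.c_mulVec a (adjoin_le hK ha), hav, D.c_u])
  have hsurj : Function.Surjective fun w : Fin n → ℝ => a *ᵥ w :=
    Matrix.mulVec_surjective_iff_isUnit.2 hu
  refine (hsurj.denseRange.dense_image (by fun_prop) h).mono ?_
  rintro _ ⟨_, ⟨A, hA, rfl⟩, rfl⟩
  refine ⟨A, hA, ?_⟩
  have hc : Commute a A := commute_of_mem_adjoin_image hG a ha A
    (Algebra.subset_adjoin ⟨A, hA, rfl⟩)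
  simp only [← hav, Matrix.mulVec_mulVec, hc.eq]

/-- If the orbit of `u` is dense, then so is the set of logarithms of `G` evaluated at `u`. -/
theorem dense_logOrbit (hG : ∀ A ∈ G, ∀ B ∈ G, A * B = B * A)
    (hK : ∀ A ∈ G, (A : Matrix (Fin n) (Fin n) ℝ) ∈ D.K) (h : Dense (orbit G D.u)) :
    Dense (D.logOrbit G) := by
  obtain ⟨𝔸, _, _, f, _, hf, hfA⟩ :=
    exists_normedCommRing_of_commute _ (commute_of_mem_adjoin_image hG)
  have : CompleteSpace 𝔸 := FiniteDimensional.complete ℝ 𝔸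
  have hu : ∀ v, ∃ a, f a *ᵥ D.u = v := fun v => by
    obtain ⟨a, ha, hav⟩ := exists_adjoin_mulVec_eq h v
    rw [← hfA] at ha
    obtain ⟨b, rfl⟩ := ha
    exact ⟨b, hav⟩
  let E := evalEquiv f hf D.u hu
  have hEc : Continuous E := E.toLinearMap.continuous_of_finiteDimensional
  have hEo : IsOpenMap E := E.toLinearMap.isOpenMap_of_finiteDimensional E.surjective
  rw [dense_iff_inter_open]
  rintro O hO ⟨v, hv⟩
  -- A point of `G u` in this open set is `E (exp y)` with `E y` in `O`; injectivity of `E` then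
  -- gives `exp y` in `G`.
  have hO' : IsOpen (E '' (exp '' (E ⁻¹' O))) := hEo _ (isOpenMap_exp _ (hO.preimage hEc))
  obtain ⟨_, ⟨_, ⟨y, hy, rfl⟩, rfl⟩, A, hA, hEA⟩ := h.inter_open_nonempty _ hO'
    ⟨_, _, ⟨E.symm v, by simpa using hv, rfl⟩, rfl⟩
  obtain ⟨a, ha⟩ : (A : Matrix (Fin n) (Fin n) ℝ) ∈ f.range := by
    rw [hfA]; exact Algebra.subset_adjoin ⟨A, hA, rfl⟩
  have hya : exp y = a := E.injective (hEA.trans (by rw [← ha]; rfl))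
  have hyK : f y ∈ D.K := adjoin_le hK (hfA ▸ ⟨y, rfl⟩)
  refine ⟨E y, hy, f y, ⟨hyK, A, hA, ?_⟩, rfl⟩
  rw [← map_exp_matrix, hya]
  exact ha

/-- If the orbit of `u` is dense, then every pattern of signs of the real eigenvalues occurs
in `G`, in particular those with one negative sign. -/
theorem exists_neg_of_dense_orbit (h : Dense (orbit G D.u)) (k : Fin r) :
    ∃ A ∈ G, (D.c ((A : Matrix (Fin n) (Fin n) ℝ) *ᵥ D.u)).1 k < 0 ∧
      ∀ i, i ≠ k → 0 < (D.c ((A : Matrix (Fin n) (Fin n) ℝ) *ᵥ D.u)).1 i := by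
  let W : Set (Eigen r s) :=
    (Set.univ.pi fun i => if i = k then Set.Iio 0 else Set.Ioi 0) ×ˢ Set.univ
  have hW : IsOpen W := by
    refine (isOpen_set_pi Set.finite_univ fun i _ => ?_).prod isOpen_univ
    split_ifs
    exacts [isOpen_Iio, isOpen_Ioi]
  obtain ⟨v, hv⟩ := D.c_surjective (fun i => if i = k then -1 else 1, 0)
  obtain ⟨_, hw, A, hA, rfl⟩ := h.inter_open_nonempty _ (hW.preimage D.continuous_c) ⟨v, by
    simp only [Set.mem_preimage, hv, W, Set.mem_prod, Set.mem_pi, Set.mem_univ, and_true]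
    intro i _
    split_ifs <;> simp⟩
  have hw' := (Set.mem_prod.1 hw).1
  refine ⟨A, hA, by simpa using hw' k trivial, fun i hi => by simpa [hi] using hw' i trivial⟩

/-- The section `τ` of `c` splits the space as `Eigen r s` plus `ker c`, so the preimage is the
image of a product of connected sets. -/
theorem isPreconnected_preimage_positiveEigen :
    IsPreconnected (D.c ⁻¹' positiveEigen r s) := by
  let τ : Eigen r s →ₗ[ℝ] (Fin n → ℝ) :=
    ((Matrix.mulVecBilin ℝ ℝ).flip D.u).comp D.σ.toLinearMap
  have hτ : ∀ a, D.c (τ a) = a := D.c_σ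
  have hcτ : Continuous τ := τ.continuous_of_finiteDimensional
  have := ((isPreconnected_positiveEigen r s).prod
    (isPreconnected_univ (α := LinearMap.ker D.c))).image
    (fun p => τ p.1 + (p.2 : Fin n → ℝ)) (by fun_prop)
  convert this using 1
  ext v
  constructor
  · intro hv
    exact ⟨(D.c v, ⟨v - τ (D.c v), by simp [hτ]⟩), ⟨hv, trivial⟩, by simp⟩
  · rintro ⟨⟨a, w⟩, ⟨ha, -⟩, rfl⟩
    simpa [hτ] using ha

theorem c_mul (hK : ∀ A ∈ G, (A : Matrix (Fin n) (Fin n) ℝ) ∈ D.K) {A : GL (Fin n) ℝ}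
    (hA : A ∈ G) (B : GL (Fin n) ℝ) :
    D.c (((A * B : GL (Fin n) ℝ) : Matrix (Fin n) (Fin n) ℝ) *ᵥ D.u) =
      D.c ((A : Matrix (Fin n) (Fin n) ℝ) *ᵥ D.u) *
        D.c ((B : Matrix (Fin n) (Fin n) ℝ) *ᵥ D.u) := by
  rw [Units.val_mul, ← Matrix.mulVec_mulVec, D.c_mulVec _ (hK A hA)]

theorem exists_sign_pattern (hK : ∀ A ∈ G, (A : Matrix (Fin n) (Fin n) ℝ) ∈ D.K)
    (hsign : ∀ k, ∃ A ∈ G, (D.c ((A : Matrix (Fin n) (Fin n) ℝ) *ᵥ D.u)).1 k < 0 ∧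
      ∀ i, i ≠ k → 0 < (D.c ((A : Matrix (Fin n) (Fin n) ℝ) *ᵥ D.u)).1 i)
    (S : Finset (Fin r)) :
    ∃ A ∈ G, ∀ i, if i ∈ S then (D.c ((A : Matrix (Fin n) (Fin n) ℝ) *ᵥ D.u)).1 i < 0
      else 0 < (D.c ((A : Matrix (Fin n) (Fin n) ℝ) *ᵥ D.u)).1 i := by
  induction S using Finset.induction_on with
  | empty => exact ⟨1, one_mem _, fun i => by simp [D.c_u]⟩
  | insert k S hk ih =>
    obtain ⟨A, hA, h⟩ := ih
    obtain ⟨B, hB, hBk, hBi⟩ := hsign k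
    refine ⟨B * A, mul_mem hB hA, fun i => ?_⟩
    rw [D.c_mul hK hB, Prod.fst_mul, Pi.mul_apply]
    have hi := h i
    by_cases hik : i = k
    · subst hik
      rw [if_neg hk] at hi
      rw [if_pos (Finset.mem_insert_self _ _)]
      exact mul_neg_of_neg_of_pos hBk hi
    · have := hBi i hik
      by_cases hS : i ∈ S
      · rw [if_pos hS] at hi
        rw [if_pos (Finset.mem_insert_of_mem hS)]
        exact mul_neg_of_pos_of_neg this hi
      · rw [if_neg hS] at hi
        rw [if_neg (by simp [hik, hS])]
        exact mul_pos this hi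

/-- If the logarithms of `G` evaluated at `u` are dense and all sign patterns with one negative
sign occur in `G`, then the orbit of `u` is dense. -/
theorem dense_orbit_of_dense_logOrbit (hG : ∀ A ∈ G, ∀ B ∈ G, A * B = B * A)
    (hK : ∀ A ∈ G, (A : Matrix (Fin n) (Fin n) ℝ) ∈ D.K) (h : Dense (D.logOrbit G))
    (hsign : ∀ k, ∃ A ∈ G, (D.c ((A : Matrix (Fin n) (Fin n) ℝ) *ᵥ D.u)).1 k < 0 ∧
      ∀ i, i ≠ k → 0 < (D.c ((A : Matrix (Fin n) (Fin n) ℝ) *ᵥ D.u)).1 i) :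
    Dense (orbit G D.u) := by
  -- The algebra is generated by the logarithms, not by `G`, which it need not contain.
  obtain ⟨𝔸, _, _, f, _, hf, hfA⟩ :=
    exists_normedCommRing_of_commute _ (commute_of_mem_adjoin (commute_of_mem_logSet (D := D) hG))
  have hle : Algebra.adjoin ℝ (D.logSet G) ≤ D.K := Algebra.adjoin_le fun B hB => hB.1
  have hfK : ∀ x, f x ∈ D.K := fun x => hle (hfA ▸ ⟨x, rfl⟩)
  have : CompleteSpace 𝔸 := FiniteDimensional.complete ℝ 𝔸
  let _ : NormedAlgebra ℚ 𝔸 := NormedAlgebra.restrictScalars ℚ ℝ 𝔸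
  have hu : ∀ v, ∃ a, f a *ᵥ D.u = v := fun v => by
    obtain ⟨a, ha, hav⟩ := exists_mulVec_eq_of_dense
      (A := Algebra.adjoin ℝ (D.logSet G)) (v := D.u) h (by
        rintro _ ⟨B, hB, rfl⟩
        exact ⟨B, Algebra.subset_adjoin hB, rfl⟩) v
    rw [← hfA] at ha
    obtain ⟨b, rfl⟩ := ha
    exact ⟨b, hav⟩
  let E := evalEquiv f hf D.u hu
  have hEc : Continuous E := E.toLinearMap.continuous_of_finiteDimensional
  have hEc' : Continuous E.symm := E.symm.toLinearMap.continuous_of_finiteDimensional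
  have hfc : Continuous f := f.toLinearMap.continuous_of_finiteDimensional
  have hexp : E.symm '' (D.c ⁻¹' positiveEigen r s) ⊆ Set.range (exp : 𝔸 → 𝔸) := by
    refine subset_range_exp
      (D.isPreconnected_preimage_positiveEigen.image _ hEc'.continuousOn) ?_ ?_
    · rintro _ ⟨v, hv, rfl⟩
      have hv' := mem_positiveEigen.1 hv
      have hEv : f (E.symm v) *ᵥ D.u = v := E.apply_symm_apply v
      have hunit : IsUnit (f (E.symm v)) := D.isUnit (hfK _) (by
        rw [hEv]
        exact isUnit_of_forall_ne_zero (fun k => (hv'.1 k).ne') hv'.2)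
      -- Invertibility as a matrix descends to `𝔸`: an injective multiplication in finite dimension
      -- is surjective and so reaches 1.
      have hinj : Function.Injective (LinearMap.mulLeft ℝ (E.symm v)) := fun x y hxy =>
        hf (hunit.mul_left_cancel (by simpa using congrArg f hxy))
      obtain ⟨y, hy⟩ := LinearMap.surjective_of_injective hinj 1
      exact IsUnit.of_mul_eq_one y hy
    · refine ⟨D.u, ?_, E.symm_apply_eq.2 (by simp [E])⟩
      rw [Set.mem_preimage, D.c_u, mem_positiveEigen]
      simp
  have hdense : Dense (D.c ⁻¹' ((Set.univ.pi fun _ => {0}ᶜ) ×ˢ (Set.univ.pi fun _ => {0}ᶜ))) :=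
    Dense.preimage ((dense_pi _ fun _ _ => dense_compl_singleton _).prod
      (dense_pi _ fun _ _ => dense_compl_singleton _))
      (D.c.isOpenMap_of_finiteDimensional D.c_surjective)
  rw [dense_iff_inter_open]
  intro O hO hne
  obtain ⟨v, hvO, hv⟩ := hdense.inter_open_nonempty O hO hne
  have hv₁ : ∀ k, (D.c v).1 k ≠ 0 := fun k => by simpa using (Set.mem_prod.1 hv).1 k trivial
  have hv₂ : ∀ l, (D.c v).2 l ≠ 0 := fun l => by simpa using (Set.mem_prod.1 hv).2 l trivial
  -- `A` gets the signs of `v`, so `A⁻¹ v` has positive real leading entries.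
  obtain ⟨A, hA, hAs⟩ := D.exists_sign_pattern hK hsign {k | (D.c v).1 k < 0}
  set w : Fin n → ℝ := ((A⁻¹ : GL (Fin n) ℝ) : Matrix (Fin n) (Fin n) ℝ) *ᵥ v with hw
  have hAw : (A : Matrix (Fin n) (Fin n) ℝ) *ᵥ w = v := by
    rw [hw, Matrix.mulVec_mulVec, Units.mul_inv, Matrix.one_mulVec]
  have hcw := D.c_mulVec A (hK A hA) w
  rw [hAw] at hcw
  have hwpos : D.c w ∈ positiveEigen r s := by
    refine mem_positiveEigen.2 ⟨fun k => ?_, fun l hl => hv₂ l ?_⟩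
    · have hk : (D.c v).1 k = _ * (D.c w).1 k := congrFun (congrArg Prod.fst hcw) k
      have hAk := hAs k
      simp only [Finset.mem_filter, Finset.mem_univ, true_and] at hAk
      split_ifs at hAk with hneg
      · rw [hk] at hneg
        exact pos_of_mul_neg_right hneg hAk.le
      · have : 0 < (D.c v).1 k := lt_of_le_of_ne (not_lt.1 hneg) (hv₁ k).symm
        rw [hk] at this
        exact (pos_iff_pos_of_mul_pos this).1 hAk
    · have : (D.c v).2 l = _ * (D.c w).2 l := congrFun (congrArg Prod.snd hcw) l
      rw [this, hl, mul_zero]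
  obtain ⟨y, hy⟩ := hexp ⟨w, hwpos, rfl⟩
  -- `F` sends `E y` to `v`, and sends `B u` to `A (exp B) u`, a point of `G u`, for each logarithm
  -- `B`.
  let F : (Fin n → ℝ) → (Fin n → ℝ) := fun x =>
    (A : Matrix (Fin n) (Fin n) ℝ) *ᵥ E (exp (E.symm x))
  have hF : Continuous F := by
    have : Continuous (exp : 𝔸 → 𝔸) := exp_continuous
    fun_prop
  obtain ⟨_, hx, B, hB, rfl⟩ := h.inter_open_nonempty _ (hO.preimage hF) ⟨E y, by
    simpa [F, hy, hAw] using hvO⟩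
  obtain ⟨b, hb⟩ : B ∈ f.range := by
    rw [hfA]; exact Algebra.subset_adjoin hB
  have hb' : f b = B := hb
  have hEb : E.symm (B *ᵥ D.u) = b := E.symm_apply_eq.2 (by rw [← hb']; rfl)
  obtain ⟨-, A', hA', hBA'⟩ := hB
  refine ⟨_, hx, A * A', mul_mem hA hA', ?_⟩
  simp only [F, hEb]
  rw [Units.val_mul, ← hBA', ← hb', ← map_exp_matrix, ← Matrix.mulVec_mulVec]
  rfl

end BlockModel

/-! ### Triangular blocks, real and complex -/

/-- The algebra of lower triangular matrices with constant diagonal. -/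
def lowerAlgebra (𝕜 : Type*) [Field 𝕜] [Algebra ℝ 𝕜] (m : ℕ) :
    Subalgebra ℝ (Matrix (Fin m) (Fin m) 𝕜) where
  carrier := {M | (∃ μ, ∀ i, M i i = μ) ∧ ∀ i j, i < j → M i j = 0}
  mul_mem' := by
    rintro M N ⟨⟨μ, hμ⟩, hM⟩ ⟨⟨ν, hν⟩, hN⟩
    refine ⟨⟨μ * ν, fun i => ?_⟩, fun i j hij => ?_⟩
    · rw [Matrix.mul_apply, Finset.sum_eq_single i, hμ, hν]
      · intro j _ hj
        rcases lt_or_gt_of_ne hj with h | h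
        · rw [hN _ _ h, mul_zero]
        · rw [hM _ _ h, zero_mul]
      · simp
    · rw [Matrix.mul_apply]
      refine Finset.sum_eq_zero fun k _ => ?_
      rcases lt_or_ge i k with h | h
      · rw [hM _ _ h, zero_mul]
      · rw [hN _ _ (h.trans_lt hij), mul_zero]
  add_mem' := by
    rintro M N ⟨⟨μ, hμ⟩, hM⟩ ⟨⟨ν, hν⟩, hN⟩
    exact ⟨⟨μ + ν, fun i => by rw [Matrix.add_apply, hμ, hν]⟩, fun i j hij => by
      rw [Matrix.add_apply, hM i j hij, hN i j hij, add_zero]⟩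
  algebraMap_mem' t := ⟨⟨algebraMap ℝ 𝕜 t, fun i => by simp [Matrix.algebraMap_matrix_apply]⟩,
    fun i j hij => by simp [Matrix.algebraMap_matrix_apply, hij.ne]⟩

theorem charpoly_of_mem_lowerAlgebra {𝕜 : Type*} [Field 𝕜] [Algebra ℝ 𝕜] {m : ℕ}
    {M : Matrix (Fin m) (Fin m) 𝕜} (hM : M ∈ lowerAlgebra 𝕜 m) {μ : 𝕜} (hμ : ∀ i, M i i = μ) :
    M.charpoly = (Polynomial.X - Polynomial.C μ) ^ m := by
  have : Mᵀ.IsUpperTriangular := fun i j hij => hM.2 j i hij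
  rw [← Matrix.charpoly_transpose, Matrix.charpoly_of_isUpperTriangular _ this]
  simp [hμ]

theorem pow_eq_zero_of_mem_lowerAlgebra {𝕜 : Type*} [Field 𝕜] [Algebra ℝ 𝕜] {m : ℕ}
    {M : Matrix (Fin m) (Fin m) 𝕜} (hM : M ∈ lowerAlgebra 𝕜 m) (h0 : ∀ i, M i i = 0) :
    M ^ m = 0 := by
  have := M.aeval_self_charpoly
  rw [charpoly_of_mem_lowerAlgebra hM h0] at this
  simpa using this

theorem hasEigenvalue_iff_of_mem_lowerAlgebra {m : ℕ} (hm : 0 < m)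
    {M : Matrix (Fin m) (Fin m) ℝ} (hM : M ∈ lowerAlgebra ℝ m) {μ : ℝ} :
    Module.End.HasEigenvalue (Matrix.toLin' M) μ ↔ μ = M ⟨0, hm⟩ ⟨0, hm⟩ := by
  obtain ⟨ν, hν⟩ := hM.1
  rw [Module.End.hasEigenvalue_iff_isRoot_charpoly, Matrix.charpoly_toLin',
    charpoly_of_mem_lowerAlgebra hM hν, hν, Polynomial.IsRoot, Polynomial.eval_pow,
    pow_eq_zero_iff hm.ne', Polynomial.eval_sub, Polynomial.eval_X, Polynomial.eval_C, sub_eq_zero]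

/-- A complex matrix as a real matrix of twice the size. -/
noncomputable def realify (m : ℕ) :
    Matrix (Fin m) (Fin m) ℂ →ₐ[ℝ] Matrix (Fin m × Fin 2) (Fin m × Fin 2) ℝ :=
  (Matrix.compAlgEquiv (Fin m) (Fin 2) ℝ ℝ).toAlgHom.comp
    (Algebra.leftMulMatrix Complex.basisOneI).mapMatrix

theorem realify_apply {m : ℕ} (C : Matrix (Fin m) (Fin m) ℂ) (i j : Fin m) (a b : Fin 2) :
    realify m C (i, a) (j, b) =
      (!![(C i j).re, -(C i j).im; (C i j).im, (C i j).re] : Matrix (Fin 2) (Fin 2) ℝ) a b := by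
  rw [← Algebra.leftMulMatrix_complex]
  rfl

theorem mem_BSet_iff {m : ℕ} {M : Matrix (Fin m × Fin 2) (Fin m × Fin 2) ℝ} :
    M ∈ BSet m ↔ ∃ C ∈ lowerAlgebra ℂ m, realify m C = M := by
  constructor
  · rintro ⟨C, hS, ⟨D, hD⟩, hC, rfl⟩
    choose α β hαβ using hS
    -- In the basis `1, i`, the block with rows `(α, β)` and `(-β, α)` is multiplication by `α - β
    -- i`.
    refine ⟨Matrix.of fun i j => ⟨α i j, -β i j⟩,
      ⟨⟨⟨D 0 0, -D 0 1⟩, fun i => ?_⟩, fun i j hij => ?_⟩, ?_⟩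
    · simp [← hD i, hαβ i i]
    · have := hαβ i j
      rw [hC i j hij] at this
      have h0 := congrFun (congrFun this 0) 0
      have h1 := congrFun (congrFun this 0) 1
      simp at h0 h1
      simp [Complex.ext_iff, ← h0, ← h1]
    · ext ⟨i, a⟩ ⟨j, b⟩
      rw [realify_apply, Matrix.comp_apply, hαβ i j]
      simp
  · rintro ⟨C, ⟨⟨μ, hμ⟩, hC⟩, rfl⟩
    refine ⟨Matrix.of fun i j => !![(C i j).re, -(C i j).im; (C i j).im, (C i j).re],
      fun i j => ⟨(C i j).re, -(C i j).im, by simp⟩,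
      ⟨!![μ.re, -μ.im; μ.im, μ.re], fun i => by rw [Matrix.of_apply, hμ]⟩,
      fun i j hij => ?_, ?_⟩
    · rw [Matrix.of_apply, hC i j hij]
      ext a b
      fin_cases a <;> fin_cases b <;> simp
    · ext ⟨i, a⟩ ⟨j, b⟩
      rw [realify_apply]
      rfl

/-! ### The block diagonal algebra and its leading coordinates -/

namespace BlockPartition

variable {n r s : ℕ} (η : BlockPartition n r s)

/-- The families of real and complex diagonal blocks. -/
abbrev Blocks : Type :=
  (∀ k, Matrix (Fin (η.realSize k)) (Fin (η.realSize k)) ℝ) ×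
    (∀ l, Matrix (Fin (η.complexSize l)) (Fin (η.complexSize l)) ℂ)

/-- The families of lower triangular blocks with constant diagonal. -/
noncomputable def lowerBlocks : Subalgebra ℝ η.Blocks :=
  (Subalgebra.pi Set.univ fun k => lowerAlgebra ℝ (η.realSize k)).prod
    (Subalgebra.pi Set.univ fun l => lowerAlgebra ℂ (η.complexSize l))

theorem mem_lowerBlocks {x : η.Blocks} : x ∈ η.lowerBlocks ↔
    (∀ k, x.1 k ∈ lowerAlgebra ℝ (η.realSize k)) ∧
      ∀ l, x.2 l ∈ lowerAlgebra ℂ (η.complexSize l) := by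
  simp [lowerBlocks, Subalgebra.mem_prod, Subalgebra.mem_pi]

/-- The block diagonal matrix with given real and complex blocks. -/
noncomputable def assemble : η.Blocks →ₐ[ℝ] Matrix (Fin n) (Fin n) ℝ :=
  AlgHom.ofLinearMap
    { toFun := fun x => Matrix.reindex η.indexEquiv η.indexEquiv
        (Matrix.fromBlocks (Matrix.blockDiagonal' x.1) 0 0
          (Matrix.blockDiagonal' fun l => realify _ (x.2 l)))
      map_add' := fun x y => by
        rw [← Matrix.coe_reindexLinearEquiv ℝ ℝ, ← map_add, Matrix.fromBlocks_add,
          ← Matrix.blockDiagonal'_add, ← Matrix.blockDiagonal'_add]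
        simp [Pi.add_def]
      map_smul' := fun t x => by
        rw [← Matrix.coe_reindexLinearEquiv ℝ ℝ, ← map_smul, Matrix.fromBlocks_smul,
          ← Matrix.blockDiagonal'_smul, ← Matrix.blockDiagonal'_smul]
        simp [Pi.smul_def] }
    (by
      simp only [LinearMap.coe_mk, AddHom.coe_mk, Prod.fst_one, Prod.snd_one, Pi.one_apply,
        map_one]
      rw [← Pi.one_def, Matrix.blockDiagonal'_one, Matrix.blockDiagonal'_one,
        Matrix.fromBlocks_one]
      simp)
    (fun x y => by
      simp only [LinearMap.coe_mk, AddHom.coe_mk, Prod.fst_mul, Prod.snd_mul, Pi.mul_apply,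
        map_mul]
      rw [← Matrix.coe_reindexAlgEquiv ℝ ℝ, ← map_mul, Matrix.fromBlocks_multiply,
        ← Matrix.blockDiagonal'_mul, ← Matrix.blockDiagonal'_mul]
      simp [Pi.mul_def])

theorem assemble_apply (x : η.Blocks) : η.assemble x =
    Matrix.reindex η.indexEquiv η.indexEquiv
      (Matrix.fromBlocks (Matrix.blockDiagonal' x.1) 0 0
        (Matrix.blockDiagonal' fun l => realify _ (x.2 l))) := rfl

theorem mem_KSet_iff {M : Matrix (Fin n) (Fin n) ℝ} :
    M ∈ η.KSet ↔ ∃ x ∈ η.lowerBlocks, η.assemble x = M := by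
  constructor
  · rintro ⟨T, B, hT, hB, rfl⟩
    choose C hC hCB using fun l => mem_BSet_iff.1 (hB l)
    refine ⟨(T, C), (η.mem_lowerBlocks).2 ⟨hT, hC⟩, ?_⟩
    simp only [assemble_apply, hCB]
  · rintro ⟨x, hx, rfl⟩
    rw [mem_lowerBlocks] at hx
    exact ⟨x.1, fun l => realify _ (x.2 l), hx.1,
      fun l => mem_BSet_iff.2 ⟨_, hx.2 l, rfl⟩, rfl⟩

theorem realBlock_assemble (x : η.Blocks) (k : Fin r) : η.realBlock (η.assemble x) k = x.1 k := by
  ext i j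
  simp [realBlock, assemble_apply]

/-- The leading coordinates of the blocks of a vector. -/
def leading : (Fin n → ℝ) →ₗ[ℝ] Eigen r s where
  toFun v := (fun k => v (η.indexEquiv (Sum.inl ⟨k, ⟨0, η.realSize_pos k⟩⟩)), fun l =>
    ⟨v (η.indexEquiv (Sum.inr ⟨l, (⟨0, η.complexSize_pos l⟩, 0)⟩)),
      v (η.indexEquiv (Sum.inr ⟨l, (⟨0, η.complexSize_pos l⟩, 1)⟩))⟩)
  map_add' v w := rfl
  map_smul' t v := by
    ext
    · simp
    · simp [Complex.ext_iff]

/-- The leading diagonal entries of the blocks. -/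
def diagEntries (x : η.Blocks) : Eigen r s :=
  (fun k => x.1 k ⟨0, η.realSize_pos k⟩ ⟨0, η.realSize_pos k⟩,
    fun l => x.2 l ⟨0, η.complexSize_pos l⟩ ⟨0, η.complexSize_pos l⟩)

theorem leading_u₀ : η.leading η.u₀ = 1 := by
  ext
  · simp [leading, u₀]
  · simp [leading, u₀, Complex.ext_iff]

theorem assemble_mulVec (x : η.Blocks) (v : Fin n → ℝ) (p : η.Index) :
    (η.assemble x *ᵥ v) (η.indexEquiv p) =
      ∑ q, Matrix.fromBlocks (Matrix.blockDiagonal' x.1) 0 0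
        (Matrix.blockDiagonal' fun l => realify _ (x.2 l)) p q * v (η.indexEquiv q) := by
  rw [Matrix.mulVec, dotProduct, ← η.indexEquiv.sum_comp]
  simp [assemble_apply]

theorem assemble_mulVec_inl (x : η.Blocks) (v : Fin n → ℝ) (k : Fin r)
    (i : Fin (η.realSize k)) :
    (η.assemble x *ᵥ v) (η.indexEquiv (Sum.inl ⟨k, i⟩)) =
      ∑ j, x.1 k i j * v (η.indexEquiv (Sum.inl ⟨k, j⟩)) := by
  rw [assemble_mulVec, Fintype.sum_sum_type, Fintype.sum_sigma, Finset.sum_eq_single k]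
  · simp
  · intro k' _ hk'
    simp [Matrix.blockDiagonal'_apply_ne _ _ _ hk'.symm]
  · simp

theorem assemble_mulVec_inr (x : η.Blocks) (v : Fin n → ℝ) (l : Fin s)
    (i : Fin (η.complexSize l)) (a : Fin 2) :
    (η.assemble x *ᵥ v) (η.indexEquiv (Sum.inr ⟨l, (i, a)⟩)) =
      ∑ j, ∑ b, realify _ (x.2 l) (i, a) (j, b) * v (η.indexEquiv (Sum.inr ⟨l, (j, b)⟩)) := by
  rw [assemble_mulVec, Fintype.sum_sum_type, Fintype.sum_sigma, Fintype.sum_sigma,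
    Finset.sum_eq_single (s := Finset.univ (α := Fin s)) l]
  · simp [Fintype.sum_prod_type]
  · intro l' _ hl'
    simp [Matrix.blockDiagonal'_apply_ne _ _ _ hl'.symm]
  · simp

/-- The first (block) row of a lower triangular block has only its diagonal entry, so leading
coordinates are simply multiplied by it. -/
theorem leading_assemble_mulVec {x : η.Blocks} (hx : x ∈ η.lowerBlocks) (v : Fin n → ℝ) :
    η.leading (η.assemble x *ᵥ v) = η.diagEntries x * η.leading v := by
  rw [mem_lowerBlocks] at hx
  have hcol : ∀ l a, (η.assemble x *ᵥ v)
      (η.indexEquiv (Sum.inr ⟨l, (⟨0, η.complexSize_pos l⟩, a)⟩)) =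
      ∑ b, realify _ (x.2 l) (⟨0, η.complexSize_pos l⟩, a) (⟨0, η.complexSize_pos l⟩, b) *
        v (η.indexEquiv (Sum.inr ⟨l, (⟨0, η.complexSize_pos l⟩, b)⟩)) := fun l a => by
    rw [assemble_mulVec_inr]
    refine Finset.sum_eq_single _ (fun j _ hj => ?_) (by simp)
    have h0 := (hx.2 l).2 ⟨0, η.complexSize_pos l⟩ j
      (lt_of_le_of_ne (Fin.mk_le_of_le_val (Nat.zero_le _)) hj.symm)
    refine Finset.sum_eq_zero fun b _ => ?_
    rw [realify_apply, h0]
    fin_cases a <;> fin_cases b <;> simp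
  refine Prod.ext (funext fun k => ?_) (funext fun l => ?_)
  · refine (η.assemble_mulVec_inl x v k _).trans ?_
    refine Finset.sum_eq_single _ (fun j _ hj => ?_) (by simp)
    rw [(hx.1 k).2 ⟨0, η.realSize_pos k⟩ j
      (lt_of_le_of_ne (Fin.mk_le_of_le_val (Nat.zero_le _)) hj.symm), zero_mul]
  · have h0 := hcol l 0
    have h1 := hcol l 1
    simp only [realify_apply, Fin.sum_univ_two] at h0 h1
    refine Complex.ext (h0.trans ?_) (h1.trans ?_)
    · simp [leading, diagEntries]
      ring
    · simp [leading, diagEntries]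
      ring

theorem realSize_le (k : Fin r) : η.realSize k ≤ n := by
  have := Finset.single_le_sum (f := η.realSize) (fun _ _ => Nat.zero_le _) (Finset.mem_univ k)
  have := η.sum_eq
  omega

theorem complexSize_le (l : Fin s) : η.complexSize l ≤ n := by
  have := Finset.single_le_sum (f := η.complexSize) (fun _ _ => Nat.zero_le _) (Finset.mem_univ l)
  have := η.sum_eq
  omega

theorem pow_eq_zero_of_diagEntries {x : η.Blocks} (hx : x ∈ η.lowerBlocks)
    (h : η.diagEntries x = 0) : x ^ n = 0 := by
  rw [mem_lowerBlocks] at hx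
  refine Prod.ext (funext fun k => ?_) (funext fun l => ?_)
  · refine pow_eq_zero_of_le (η.realSize_le k)
      (pow_eq_zero_of_mem_lowerAlgebra (hx.1 k) fun i => ?_)
    obtain ⟨μ, hμ⟩ := (hx.1 k).1
    rw [hμ, ← hμ ⟨0, η.realSize_pos k⟩]
    exact congrFun (congrArg Prod.fst h) k
  · refine pow_eq_zero_of_le (η.complexSize_le l)
      (pow_eq_zero_of_mem_lowerAlgebra (hx.2 l) fun i => ?_)
    obtain ⟨μ, hμ⟩ := (hx.2 l).1
    rw [hμ, ← hμ ⟨0, η.complexSize_pos l⟩]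
    exact congrFun (congrArg Prod.snd h) l

/-- The families of scalar blocks. -/
noncomputable def scalarBlocks : Eigen r s →ₐ[ℝ] η.Blocks where
  toFun a := (fun k => Matrix.scalar _ (a.1 k), fun l => Matrix.scalar _ (a.2 l))
  map_one' := by ext <;> simp
  map_mul' a b := by ext <;> simp [Matrix.diagonal_apply]
  map_zero' := by ext <;> simp
  map_add' a b := by ext <;> simp only [Prod.fst_add, Prod.snd_add, Pi.add_apply, map_add]
  commutes' t := by ext <;> simp [Matrix.algebraMap_matrix_apply, Matrix.diagonal_apply]

theorem scalarBlocks_mem (a : Eigen r s) : η.scalarBlocks a ∈ η.lowerBlocks :=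
  (η.mem_lowerBlocks).2 ⟨fun k => ⟨⟨a.1 k, fun i => by simp [scalarBlocks]⟩, fun i j hij => by
    simp [scalarBlocks, hij.ne]⟩, fun l => ⟨⟨a.2 l, fun i => by simp [scalarBlocks]⟩,
    fun i j hij => by simp [scalarBlocks, hij.ne]⟩⟩

theorem scalarBlocks_commute (a : Eigen r s) (x : η.Blocks) : Commute (η.scalarBlocks a) x :=
  Prod.ext (funext fun _ => Matrix.scalar_commute _ (fun _ => Commute.all _ _) _)
    (funext fun _ => Matrix.scalar_commute _ (fun _ => Commute.all _ _) _)

theorem diagEntries_scalarBlocks (a : Eigen r s) : η.diagEntries (η.scalarBlocks a) = a := by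
  refine Prod.ext (funext fun k => ?_) (funext fun l => ?_) <;> simp [diagEntries, scalarBlocks]

end BlockPartition

/-! ### Conjugation by `P` and the concrete model -/

/-- Conjugation of matrices by an invertible matrix. -/
def conjAlgHom {n : ℕ} (P : GL (Fin n) ℝ) :
    Matrix (Fin n) (Fin n) ℝ →ₐ[ℝ] Matrix (Fin n) (Fin n) ℝ :=
  AlgHom.ofLinearMap
    { toFun := fun M => (P : Matrix (Fin n) (Fin n) ℝ) * M *
        ((P⁻¹ : GL (Fin n) ℝ) : Matrix (Fin n) (Fin n) ℝ)
      map_add' := fun M N => by rw [mul_add, add_mul]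
      map_smul' := fun t M => by simp }
    (by simp only [LinearMap.coe_mk, AddHom.coe_mk, mul_one, Units.mul_inv])
    (fun M N => by
      simp only [LinearMap.coe_mk, AddHom.coe_mk, mul_assoc, Units.inv_mul_cancel_left])

theorem conjAlgHom_apply {n : ℕ} (P : GL (Fin n) ℝ) (M : Matrix (Fin n) (Fin n) ℝ) :
    conjAlgHom P M = (P : Matrix (Fin n) (Fin n) ℝ) * M *
      ((P⁻¹ : GL (Fin n) ℝ) : Matrix (Fin n) (Fin n) ℝ) := rfl

namespace BlockPartition

variable {n r s : ℕ} (η : BlockPartition n r s) (P : GL (Fin n) ℝ)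

theorem leading_conj_mulVec {x : η.Blocks} (hx : x ∈ η.lowerBlocks) (v : Fin n → ℝ) :
    η.leading (((P⁻¹ : GL (Fin n) ℝ) : Matrix (Fin n) (Fin n) ℝ) *ᵥ
      (conjAlgHom P (η.assemble x) *ᵥ v)) = η.diagEntries x *
        η.leading (((P⁻¹ : GL (Fin n) ℝ) : Matrix (Fin n) (Fin n) ℝ) *ᵥ v) := by
  rw [← η.leading_assemble_mulVec hx, conjAlgHom_apply, Matrix.mulVec_mulVec,
    Matrix.mulVec_mulVec, mul_assoc, Units.inv_mul_cancel_left]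

theorem inv_mulVec_v₀ :
    ((P⁻¹ : GL (Fin n) ℝ) : Matrix (Fin n) (Fin n) ℝ) *ᵥ η.v₀ P = η.u₀ := by
  rw [v₀, Matrix.mulVec_mulVec, Units.inv_mul, Matrix.one_mulVec]

theorem leading_conj_mulVec_v₀ {x : η.Blocks} (hx : x ∈ η.lowerBlocks) :
    η.leading (((P⁻¹ : GL (Fin n) ℝ) : Matrix (Fin n) (Fin n) ℝ) *ᵥ
      (conjAlgHom P (η.assemble x) *ᵥ η.v₀ P)) = η.diagEntries x := by
  rw [leading_conj_mulVec η P hx, inv_mulVec_v₀, leading_u₀, mul_one]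

/-- The block model of `P 𝒦_{η,r,s}(ℝ) P⁻¹`. -/
noncomputable def model : BlockModel n r s where
  K := η.lowerBlocks.map ((conjAlgHom P).comp η.assemble)
  u := η.v₀ P
  c := η.leading ∘ₗ Matrix.toLin' ((P⁻¹ : GL (Fin n) ℝ) : Matrix (Fin n) (Fin n) ℝ)
  σ := ((conjAlgHom P).comp η.assemble).comp η.scalarBlocks
  σ_mem a := ⟨_, η.scalarBlocks_mem a, rfl⟩
  σ_commute := by
    rintro a _ ⟨x, -, rfl⟩
    exact (η.scalarBlocks_commute a x).map ((conjAlgHom P).comp η.assemble)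
  c_σ a := (leading_conj_mulVec_v₀ η P (η.scalarBlocks_mem a)).trans
    (η.diagEntries_scalarBlocks a)
  c_mulVec := by
    rintro _ ⟨x, hx, rfl⟩ v
    exact (leading_conj_mulVec η P hx v).trans
      (congrArg (· * _) (leading_conj_mulVec_v₀ η P hx).symm)
  isNilpotent := by
    rintro _ ⟨x, hx, rfl⟩ h0
    refine ⟨n, ?_⟩
    change ((conjAlgHom P).comp η.assemble) x ^ n = 0
    rw [← map_pow, η.pow_eq_zero_of_diagEntries hx
      ((leading_conj_mulVec_v₀ η P hx).symm.trans h0), map_zero]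

theorem mem_model_K {M : Matrix (Fin n) (Fin n) ℝ} :
    M ∈ (η.model P).K ↔ ∃ C ∈ η.KSet, M = (P : Matrix (Fin n) (Fin n) ℝ) * C *
      ((P⁻¹ : GL (Fin n) ℝ) : Matrix (Fin n) (Fin n) ℝ) := by
  constructor
  · rintro ⟨x, hx, rfl⟩
    exact ⟨_, η.mem_KSet_iff.2 ⟨x, hx, rfl⟩, rfl⟩
  · rintro ⟨C, hC, rfl⟩
    obtain ⟨x, hx, rfl⟩ := η.mem_KSet_iff.1 hC
    exact ⟨x, hx, rfl⟩

theorem logOrbit_model (G : Subgroup (GL (Fin n) ℝ)) :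
    (η.model P).logOrbit G = η.gOrbit G P (η.v₀ P) := by
  ext w
  simp only [BlockModel.logOrbit, BlockModel.logSet, gOrbit, gSet, mem_model_K]
  exact exists_congr fun B => and_congr_left' and_comm

/-- For a conjugate `M` of `A`, the real eigenvalues are those read off by the block model. -/
theorem forall_hasEigenvalue_iff {A : GL (Fin n) ℝ} (hA : P⁻¹ * A * P ∈ η.KStar)
    {μ : Fin r → ℝ} :
    (∀ i, Module.End.HasEigenvalue (Matrix.toLin' (η.realBlock
      ((P⁻¹ * A * P : GL (Fin n) ℝ) : Matrix (Fin n) (Fin n) ℝ) i)) (μ i)) ↔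
    μ = ((η.model P).c ((A : Matrix (Fin n) (Fin n) ℝ) *ᵥ (η.model P).u)).1 := by
  obtain ⟨x, hx, hxA⟩ := η.mem_KSet_iff.1 hA
  have hAx : (A : Matrix (Fin n) (Fin n) ℝ) = conjAlgHom P (η.assemble x) := by
    rw [hxA, conjAlgHom_apply, ← Units.val_mul, ← Units.val_mul]
    congr 1
    group
  have hc : (η.model P).c ((A : Matrix (Fin n) (Fin n) ℝ) *ᵥ (η.model P).u) =
      η.diagEntries x := by
    rw [hAx]
    exact leading_conj_mulVec_v₀ η P hx
  rw [hc, ← hxA, funext_iff]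
  refine forall_congr' fun i => ?_
  rw [realBlock_assemble, hasEigenvalue_iff_of_mem_lowerAlgebra (η.realSize_pos i)
    ((η.mem_lowerBlocks.1 hx).1 i)]
  rfl

/-- A subset of `Fin r` has `r` elements only if it is everything, and each real block has a single
eigenvalue, which forces the choice of `μ`. -/
theorem ind_eq_iff {G : Subgroup (GL (Fin n) ℝ)} (hP : conjSet G P ⊆ η.KStar) :
    η.ind (conjSet G P) = r ↔ ∀ k, ∃ A ∈ G,
      ((η.model P).c ((A : Matrix (Fin n) (Fin n) ℝ) *ᵥ (η.model P).u)).1 k < 0 ∧ ∀ i, i ≠ k →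
        0 < ((η.model P).c ((A : Matrix (Fin n) (Fin n) ℝ) *ᵥ (η.model P).u)).1 i := by
  have hcard : ∀ S : Set (Fin r), S.ncard = r ↔ ∀ k, k ∈ S := fun S => by
    rw [← Set.eq_univ_iff_forall]
    constructor
    · intro h
      exact Set.eq_of_subset_of_ncard_le (Set.subset_univ S) (by simp [Set.ncard_univ, h])
    · rintro rfl
      simp [Set.ncard_univ]
  rw [ind, hcard]
  refine forall_congr' fun k => ?_
  constructor
  · rintro ⟨_, ⟨A, hA, rfl⟩, μ, hμ, hneg, hpos⟩
    rw [forall_hasEigenvalue_iff η P (hP ⟨A, hA, rfl⟩)] at hμ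
    subst hμ
    exact ⟨A, hA, hneg, hpos⟩
  · rintro ⟨A, hA, hneg, hpos⟩
    exact ⟨_, ⟨A, hA, rfl⟩, _, (forall_hasEigenvalue_iff η P (hP ⟨A, hA, rfl⟩)).2 rfl, hneg, hpos⟩

end BlockPartition

end TopTransitive

/-! ### The main theorem -/

theorem corollary1p2 {n r s : ℕ} (hn : 1 ≤ n) (η : TopTransitive.BlockPartition n r s)
    (G : Subgroup (Matrix.GeneralLinearGroup (Fin n) ℝ))
    (hG : ∀ A ∈ G, ∀ B ∈ G, A * B = B * A)
    (P : Matrix.GeneralLinearGroup (Fin n) ℝ)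
    (hP : TopTransitive.conjSet G P ⊆ η.KStar) :
    List.TFAE [
      TopTransitive.IsTopTransitive G,
      Dense (TopTransitive.orbit G (η.v₀ P)),
      (∃ H : AddSubgroup (Fin n → ℝ), (H : Set (Fin n → ℝ)) = η.gOrbit G P (η.v₀ P)) ∧
        Dense (η.gOrbit G P (η.v₀ P)) ∧
        η.ind (TopTransitive.conjSet G P) = r] := by
  have hK : ∀ A ∈ G, (A : Matrix (Fin n) (Fin n) ℝ) ∈ (η.model P).K := fun A hA => by
    refine (η.mem_model_K P).2 ⟨_, hP ⟨A, hA, rfl⟩, ?_⟩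
    rw [← Units.val_mul, ← Units.val_mul]
    congr 1
    group
  rw [← η.logOrbit_model P G, η.ind_eq_iff P hP]
  tfae_have 1 → 2 := fun ⟨_, hv⟩ =>
    TopTransitive.BlockModel.dense_orbit_of_dense_orbit (D := η.model P) hG hK hv
  tfae_have 2 → 1 := fun h => ⟨_, h⟩
  tfae_have 2 → 3 := fun h =>
    ⟨TopTransitive.BlockModel.exists_addSubgroup_eq_logOrbit hG,
      TopTransitive.BlockModel.dense_logOrbit (D := η.model P) hG hK h,
      TopTransitive.BlockModel.exists_neg_of_dense_orbit (D := η.model P) h⟩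
  tfae_have 3 → 2 := fun h =>
    TopTransitive.BlockModel.dense_orbit_of_dense_logOrbit (D := η.model P) hG hK h.2.1 h.2.2
  tfae_finish
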